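/- Let $A$ be a (not necessarily unital) C*-algebra with positive cone $A_+$. A lower semicontinuous trace on $A$ is a map $t\colon A_+\to[0,+\infty]$ with $t(0)=0$, $t(a+b)=t(a)+t(b)$ and $t(xx^*)=t(x^*x)$ for all $x\in A$, that is lower semicontinuous for the norm topology on $A_+$. Let $T(A)$ be the set of these traces with pointwise order, pointwise addition and pointwise multiplication by real scalars $r>0$. For $a,b\in A_+$ write $a\sim b$ if there is a sequence $(x_n)$ in $A$ with $a=\sum_n x_nx_n^*$ and $b=\sum_n x_n^*x_n$ (norm convergent), and $a\prec\!\!\prec b$ if there are $a'\in A_+$ and $\varepsilon>0$ with $a\sim a'\le (b-\varepsilon)_+$. Equip $A_+$ with the topology $\tau_{\prec\!\!\prec}$ in which $U\subseteq A_+$ is open iff ($x\in U$ and $x\prec\!\!\prec y$ imply $y\in U$) and (every $x\in U$ admits $z\in U$ with $z\prec\!\!\prec x$). Let $\mathrm{LSC}(A_+)$ be the poset of all functions $A_+\to[0,+\infty]$ that are lower semicontinuous for $\tau_{\prec\!\!\prec}$, ordered pointwise; it contains $T(A)$. On a poset, the upper (resp. lower) topology is the one having the principal ideals $\{y\mid y\le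 b\}$ (resp. the principal filters $\{y\mid y\ge a\}$) as a subbasis of closed sets, and the interval topology is generated by these two. Let $\tau^*_{up}$ (the weak* upper topology), $\tau^*_{lo}$ and $\tau^*_{iv}$ be the restrictions to $T(A)$ of the upper, lower and interval topology of $\mathrm{LSC}(A_+)$. Then $T(A)$ is a cone (a commutative monoid with a multiplication by scalars $r>0$ satisfying the usual laws), and: (a) For $\tau^*_{iv}$ and the pointwise order, $T(A)$ is an ordered compact topological cone: it is compact, the graph of $\le$ is closed in $T(A)\times T(A)$, and addition and scalar multiplication $\mathbb{R}_{>0}\times T(A)\to T(A)$ are order preserving and jointly continuous, where $\mathbb{R}_{>0}$ carries the usual Hausdorff topology. (b) For $\tau^*_{up}$, $T(A)$ is a stably compact topological cone: it is stably compact (compact, locally compact, sober, and the intersection of any two compact saturated sets is compact), and addition and scalar multiplication are jointly continuous, where $\mathbb{R}_{>0}$ carries its upper topology. (c) For $\tau^*_{lo}$, $T(A)$ is a stably compact topological cone: it is stably compact, and addition and scalar multiplication are jointly continuous, where $\mathbb{R}_{>0}$ carries its lower topology. -/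

import Mathlib

open scoped ENNReal

/-! ### Topologies on posets -/

/-- The interval topology of a poset: the coarsest common refinement of the upper topology
(subbasic closed sets `↓ b`) and the lower topology (subbasic closed sets `↑ a`). -/
@[reducible]
def intervalTopology (L : Type*) [Preorder L] : TopologicalSpace L :=
  Topology.upper L ⊓ Topology.lower L

/-- A compact ordered space: a compact space with a partial order whose graph is closed. -/
structure IsCompactOrderedSpace {X : Type*} [PartialOrder X] (τ : TopologicalSpace X) : Prop where
  compact : CompactSpace X
  closed_graph : IsClosed {p : X × X | p.1 ≤ p.2}

/-- A saturated set: it equals the intersection of all open sets containing it. -/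
def IsSaturatedSet {X : Type*} (τ : TopologicalSpace X) (K : Set X) : Prop :=
  ⋂₀ {U : Set X | IsOpen U ∧ K ⊆ U} = K

/-- A stably compact space: compact, locally compact (every point has a neighbourhood basis of
compact sets), sober (every irreducible closed set is the closure of a unique point) and coherent
(the intersection of two compact saturated sets is compact). -/
structure IsStablyCompact {X : Type*} (τ : TopologicalSpace X) : Prop where
  compact : CompactSpace X
  locallyCompact : LocallyCompactSpace X
  quasiSober : QuasiSober X
  t0 : T0Space X
  coherent : ∀ K L : Set X, IsCompact K → IsSaturatedSet τ K → IsCompact L → IsSaturatedSet τ L →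
    IsCompact (K ∩ L)

/-! ### Cones -/

/-- The positive real numbers. -/
abbrev PosReal : Type := {r : ℝ // 0 < r}

/-- The usual (Hausdorff) topology on the positive reals. -/
@[reducible]
def PosReal.usualTopology : TopologicalSpace PosReal := instTopologicalSpaceSubtype

/-- A cone: a commutative monoid with a multiplication by positive real scalars satisfying
`1 • a = a`, `(r * s) • a = r • s • a`, `r • (a + b) = r • a + r • b`, `(r + s) • a = r • a + s • a`
(and `r • 0 = 0`). -/
class Cone (C : Type*) extends AddCommMonoid C, DistribMulAction PosReal C where
  add_smul' : ∀ (r s : PosReal) (a : C), (r + s) • a = r • a + s • a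

/-- A topological cone, with respect to a topology `σ` on the positive scalars and a topology `τ`
on the cone: addition and scalar multiplication are jointly continuous. -/
structure IsTopologicalCone {C : Type*} [Cone C]
    (σ : TopologicalSpace PosReal) (τ : TopologicalSpace C) : Prop where
  continuous_add : Continuous (fun p : C × C => p.1 + p.2)
  continuous_smul : Continuous (fun p : PosReal × C => p.1 • p.2)

/-- An ordered cone: addition and scalar multiplication are order preserving. -/
structure IsOrderedCone (C : Type*) [Cone C] [PartialOrder C] : Prop where
  monotone_add : Monotone (fun p : C × C => p.1 + p.2)
  monotone_smul : Monotone (fun p : PosReal × C => p.1 • p.2)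

/-! ### Predomains and lower semicontinuous functions -/

/-- The c-space topology of a relation `r` with the interpolation property: `U` is open if
`x ∈ U`, `r x y` imply `y ∈ U`, and every `x ∈ U` has some `z ∈ U` with `r z x`. -/
@[reducible]
def cSpaceTopology {P : Type*} (r : P → P → Prop) (h0 : ∀ c, ∃ b, r b c)
    (h2 : ∀ a₁ a₂ c, r a₁ c → r a₂ c → ∃ b, r a₁ b ∧ r a₂ b ∧ r b c) : TopologicalSpace P where
  IsOpen U := (∀ x ∈ U, ∀ y, r x y → y ∈ U) ∧ ∀ x ∈ U, ∃ z ∈ U, r z x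
  isOpen_univ := ⟨fun _ _ _ _ => trivial, fun x _ => (h0 x).imp fun _ h => ⟨trivial, h⟩⟩
  isOpen_inter := by
    rintro U V ⟨hU1, hU2⟩ ⟨hV1, hV2⟩
    refine ⟨fun x hx y hxy => ⟨hU1 x hx.1 y hxy, hV1 x hx.2 y hxy⟩, fun x hx => ?_⟩
    obtain ⟨z₁, hz₁, h₁⟩ := hU2 x hx.1
    obtain ⟨z₂, hz₂, h₂⟩ := hV2 x hx.2
    obtain ⟨b, hb₁, hb₂, hb⟩ := h2 z₁ z₂ x h₁ h₂
    exact ⟨b, ⟨hU1 _ hz₁ _ hb₁, hV1 _ hz₂ _ hb₂⟩, hb⟩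
  isOpen_sUnion := by
    intro S hS
    refine ⟨?_, ?_⟩
    · rintro x ⟨U, hU, hx⟩ y hxy
      exact ⟨U, hU, (hS U hU).1 x hx y hxy⟩
    · rintro x ⟨U, hU, hx⟩
      obtain ⟨z, hz, h⟩ := (hS U hU).2 x hx
      exact ⟨z, ⟨U, hU, hz⟩, h⟩

/-- The lower semicontinuous functions `P → [0, ∞]`, ordered pointwise. -/
abbrev LSC {P : Type*} (τ : TopologicalSpace P) : Type _ :=
  {f : P → ℝ≥0∞ // LowerSemicontinuous f}

/-! ### The positive cone of a C*-algebra -/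

section CStar

variable (A : Type*) [NonUnitalCStarAlgebra A] [PartialOrder A] [StarOrderedRing A]

/-- The positive cone `A₊`, carrying the norm topology of `A`. -/
abbrev PosCone : Type _ := {a : A // 0 ≤ a}

variable {A}

/-- `(a - ε)₊`, for `ε > 0`, by functional calculus. -/
noncomputable def cutoff (a : PosCone A) (ε : ℝ) : PosCone A :=
  ⟨cfcₙ (fun x : ℝ => max (x - ε) 0) (a : A), cfcₙ_nonneg fun _ _ => le_max_right _ _⟩

/-- Cuntz–Pedersen equivalence: `a = ∑ xₙ xₙ*` and `b = ∑ xₙ* xₙ` for some sequence `x` in `A`. -/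
def CPEquiv (a b : PosCone A) : Prop :=
  ∃ x : ℕ → A, HasSum (fun n => x n * star (x n)) (a : A) ∧
    HasSum (fun n => star (x n) * x n) (b : A)

/-- The Cuntz–Pedersen approximation relation `a ≺≺ b`: there are `a'` and `ε > 0` with
`a ∼ a' ≤ (b - ε)₊`. -/
def CPApprox (a b : PosCone A) : Prop :=
  ∃ a' : PosCone A, ∃ ε : ℝ, 0 < ε ∧ CPEquiv a a' ∧ a' ≤ cutoff b ε

theorem CPEquiv.refl (a : PosCone A) : CPEquiv a a := by
  obtain ⟨y, hy, hy'⟩ := CStarAlgebra.nonneg_iff_exists_isSelfAdjoint_and_eq_mul_self.mp a.2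
  refine ⟨fun n => if n = 0 then y else 0, ?_, ?_⟩
  · have := hasSum_single (f := fun n : ℕ => (if n = 0 then y else 0) *
      star (if n = 0 then y else (0 : A))) 0 (by intro n hn; simp [hn])
    simpa [hy.star_eq, ← hy'] using this
  · have := hasSum_single (f := fun n : ℕ => star (if n = 0 then y else (0 : A)) *
      (if n = 0 then y else 0)) 0 (by intro n hn; simp [hn])
    simpa [hy.star_eq, ← hy'] using this

theorem cutoff_anti (a : PosCone A) {δ ε : ℝ} (hδ : 0 ≤ δ) (h : δ ≤ ε) :
    cutoff a ε ≤ cutoff a δ := by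
  have hε := hδ.trans h
  refine cfcₙ_mono (fun x _ => max_le_max (by linarith) le_rfl) ?_ ?_ ?_ ?_
  · fun_prop
  · fun_prop
  · simp [hε]
  · simp [hδ]

theorem cutoff_cutoff (a : PosCone A) {δ ε : ℝ} (hδ : 0 ≤ δ) (hε : 0 ≤ ε) :
    cutoff (cutoff a δ) ε = cutoff a (δ + ε) := by
  apply Subtype.ext
  change cfcₙ _ (cfcₙ _ (a : A)) = cfcₙ _ (a : A)
  rw [← cfcₙ_comp' (fun x : ℝ => max (x - ε) 0) (fun x : ℝ => max (x - δ) 0) (a : A)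
    (by fun_prop) (by simp [hε]) (by fun_prop) (by simp [hδ]) a.2.isSelfAdjoint]
  refine cfcₙ_congr fun x _ => ?_
  simp only [← max_sub_sub_right]
  rw [max_assoc, max_eq_right (show (0 : ℝ) - ε ≤ 0 by linarith), sub_sub]

theorem cutoff_approx (a : PosCone A) {ε : ℝ} (hε : 0 < ε) : CPApprox (cutoff a ε) a :=
  ⟨cutoff a ε, ε, hε, CPEquiv.refl _, le_rfl⟩

theorem CPApprox.interpolate₀ (c : PosCone A) : ∃ b : PosCone A, CPApprox b c :=
  ⟨_, cutoff_approx c one_pos⟩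

theorem CPApprox.interpolate₂ (a₁ a₂ c : PosCone A) (h₁ : CPApprox a₁ c) (h₂ : CPApprox a₂ c) :
    ∃ b, CPApprox a₁ b ∧ CPApprox a₂ b ∧ CPApprox b c := by
  obtain ⟨b₁, ε₁, hε₁, e₁, l₁⟩ := h₁
  obtain ⟨b₂, ε₂, hε₂, e₂, l₂⟩ := h₂
  have hm : 0 < min ε₁ ε₂ := lt_min hε₁ hε₂
  have key : cutoff (cutoff c (min ε₁ ε₂ / 2)) (min ε₁ ε₂ / 2) = cutoff c (min ε₁ ε₂) := by
    rw [cutoff_cutoff c (half_pos hm).le (half_pos hm).le, add_halves]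
  refine ⟨cutoff c (min ε₁ ε₂ / 2), ⟨b₁, _, half_pos hm, e₁, l₁.trans ?_⟩,
    ⟨b₂, _, half_pos hm, e₂, l₂.trans ?_⟩, cutoff_approx c (half_pos hm)⟩
  · rw [key]; exact cutoff_anti c hm.le (min_le_left _ _)
  · rw [key]; exact cutoff_anti c hm.le (min_le_right _ _)

variable (A) in
/-- The c-space topology on `A₊` given by the Cuntz–Pedersen approximation relation. -/
@[reducible]
def cpTopology : TopologicalSpace (PosCone A) :=
  cSpaceTopology CPApprox CPApprox.interpolate₀ CPApprox.interpolate₂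

/-! ### The cone of lower semicontinuous traces -/

variable (A) in
/-- The lower semicontinuous traces on `A`: monoid homomorphisms `t : A₊ → [0, ∞]` which are lower
semicontinuous for the norm topology on `A₊` and satisfy `t (x x*) = t (x* x)` for all `x`. -/
structure LSCTrace extends PosCone A →+ ℝ≥0∞ where
  lsc' : LowerSemicontinuous toFun
  trace' : ∀ x : A, toFun ⟨x * star x, mul_star_self_nonneg x⟩ =
    toFun ⟨star x * x, star_mul_self_nonneg x⟩

namespace LSCTrace

instance : FunLike (LSCTrace A) (PosCone A) ℝ≥0∞ where
  coe t := t.toFun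
  coe_injective := by
    rintro ⟨s, _, _⟩ ⟨t, _, _⟩ h
    congr
    exact DFunLike.coe_injective h

instance : AddMonoidHomClass (LSCTrace A) (PosCone A) ℝ≥0∞ where
  map_add t := t.map_add'
  map_zero t := t.map_zero'

theorem lsc (t : LSCTrace A) : LowerSemicontinuous t := t.lsc'

theorem trace (t : LSCTrace A) (x : A) : t ⟨x * star x, mul_star_self_nonneg x⟩ =
    t ⟨star x * x, star_mul_self_nonneg x⟩ := t.trace' x

/-- The pointwise order. -/
instance : PartialOrder (LSCTrace A) := PartialOrder.lift (fun t => (t : PosCone A → ℝ≥0∞))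
  DFunLike.coe_injective

noncomputable instance : Zero (LSCTrace A) where
  zero := { (0 : PosCone A →+ ℝ≥0∞) with
    lsc' := lowerSemicontinuous_const
    trace' := fun _ => rfl }

/-- Pointwise addition. -/
noncomputable instance : Add (LSCTrace A) where
  add s t := { s.toAddMonoidHom + t.toAddMonoidHom with
    lsc' := s.lsc.add t.lsc
    trace' := fun x => congrArg₂ (· + ·) (s.trace x) (t.trace x) }

/-- Pointwise multiplication by positive scalars. -/
noncomputable instance : SMul PosReal (LSCTrace A) where
  smul r t :=
  { toFun := fun a => ENNReal.ofReal r * t a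
    map_zero' := by simp
    map_add' := fun a b => by rw [map_add, mul_add]
    lsc' := (ENNReal.continuous_const_mul ENNReal.ofReal_ne_top).comp_lowerSemicontinuous t.lsc
      fun _ _ h => mul_le_mul_right h _
    trace' := fun x => congrArg (ENNReal.ofReal r * ·) (t.trace x) }

@[simp] theorem zero_apply (a : PosCone A) : (0 : LSCTrace A) a = 0 := rfl

@[simp] theorem add_apply (s t : LSCTrace A) (a : PosCone A) : (s + t) a = s a + t a := rfl

@[simp] theorem smul_apply (r : PosReal) (t : LSCTrace A) (a : PosCone A) :
    (r • t) a = ENNReal.ofReal r * t a := rfl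

noncomputable instance : Cone (LSCTrace A) where
  add_assoc s t u := DFunLike.ext _ _ fun a => add_assoc _ _ _
  zero_add t := DFunLike.ext _ _ fun a => zero_add _
  add_zero t := DFunLike.ext _ _ fun a => add_zero _
  add_comm s t := DFunLike.ext _ _ fun a => add_comm _ _
  nsmul := nsmulRec
  one_smul t := DFunLike.ext _ _ fun a => by simp
  mul_smul r s t := DFunLike.ext _ _ fun a => by
    simp [ENNReal.ofReal_mul r.2.le, mul_assoc]
  smul_zero r := DFunLike.ext _ _ fun a => by simp
  smul_add r s t := DFunLike.ext _ _ fun a => by simp [mul_add]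
  add_smul' r s t := DFunLike.ext _ _ fun a => by
    simp [ENNReal.ofReal_add r.2.le s.2.le, add_mul]

theorem mono (t : LSCTrace A) {a b : PosCone A} (h : a ≤ b) : t a ≤ t b := by
  have hb : b = a + ⟨(b : A) - a, sub_nonneg.mpr h⟩ := Subtype.ext (by simp)
  rw [hb, map_add]
  exact le_self_add

theorem eq_tsum (t : LSCTrace A) {y : ℕ → PosCone A} {a : PosCone A}
    (h : HasSum (fun n => (y n : A)) (a : A)) : t a = ∑' n, t (y n) := by
  have hs : ∀ s : Finset ℕ, ((∑ n ∈ s, y n : PosCone A) : A) = ∑ n ∈ s, (y n : A) := fun s =>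
    map_sum (AddSubmonoid.subtype (AddSubmonoid.nonneg A)) y s
  apply le_antisymm
  · refine le_of_forall_lt fun r hr => ?_
    have ht : Filter.Tendsto (fun s : Finset ℕ => ∑ n ∈ s, y n) Filter.atTop (nhds a) := by
      rw [tendsto_subtype_rng]
      exact h.congr fun s => (hs s).symm
    obtain ⟨s, hs'⟩ := (ht.eventually (t.lsc a r hr)).exists
    rw [map_sum] at hs'
    exact hs'.trans_le (ENNReal.sum_le_tsum s)
  · rw [ENNReal.tsum_eq_iSup_sum]
    refine iSup_le fun s => ?_
    rw [← map_sum]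
    refine t.mono (Subtype.coe_le_coe.mp ?_)
    rw [hs]
    exact sum_le_hasSum s (fun n _ => (y n).2) h

theorem eq_of_equiv (t : LSCTrace A) {a b : PosCone A} (h : CPEquiv a b) : t a = t b := by
  obtain ⟨x, ha, hb⟩ := h
  rw [t.eq_tsum (y := fun n => ⟨x n * star (x n), mul_star_self_nonneg _⟩) ha,
    t.eq_tsum (y := fun n => ⟨star (x n) * x n, star_mul_self_nonneg _⟩) hb]
  exact tsum_congr fun n => t.trace (x n)

theorem le_of_approx (t : LSCTrace A) {a b : PosCone A} (h : CPApprox a b) : t a ≤ t b := by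
  obtain ⟨a', ε, hε, e, l⟩ := h
  rw [t.eq_of_equiv e]
  refine t.mono (l.trans (Subtype.coe_le_coe.mp ?_))
  conv_rhs => rw [← cfcₙ_id' ℝ (b : A) b.2.isSelfAdjoint]
  refine cfcₙ_mono (fun x hx => ?_) (by fun_prop) (by fun_prop) (by simp [hε.le]) rfl
  exact max_le (by linarith) (quasispectrum_nonneg_of_nonneg _ b.2 x hx)

theorem tendsto_cutoff (a : PosCone A) :
    Filter.Tendsto (cutoff a) (nhdsWithin 0 (Set.Ioi 0)) (nhds a) := by
  rw [tendsto_subtype_rng, tendsto_iff_norm_sub_tendsto_zero]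
  refine squeeze_zero' (g := fun ε : ℝ => ε) (Filter.Eventually.of_forall fun _ => norm_nonneg _)
    ?_ (nhdsWithin_le_nhds)
  filter_upwards [self_mem_nhdsWithin] with ε hε
  have hε : 0 < ε := hε
  have key : (cutoff a ε : A) - (a : A) = cfcₙ (fun x : ℝ => max (x - ε) 0 - x) (a : A) := by
    rw [cfcₙ_sub (fun x : ℝ => max (x - ε) 0) (fun x : ℝ => x) (a : A) (by fun_prop)
      (by simp [hε.le]) (by fun_prop) rfl, cfcₙ_id' ℝ (a : A) a.2.isSelfAdjoint]
    rfl
  rw [key]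
  refine norm_cfcₙ_le fun x hx => ?_
  have hx := quasispectrum_nonneg_of_nonneg _ a.2 x hx
  rw [Real.norm_eq_abs, abs_le]
  constructor
  · linarith [le_max_left (x - ε) 0]
  · rcases max_cases (x - ε) 0 with h | h <;> linarith

/-- A lower semicontinuous trace is lower semicontinuous for the c-space topology on `A₊`. -/
theorem lsc_cp (t : LSCTrace A) :
    @LowerSemicontinuous (PosCone A) ℝ≥0∞ (cpTopology A) _ t := by
  let _ := cpTopology A
  rw [lowerSemicontinuous_iff_isOpen_preimage]
  refine fun r => ⟨fun x hx y hxy => lt_of_lt_of_le hx (t.le_of_approx hxy), fun x hx => ?_⟩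
  obtain ⟨ε, h, hε⟩ := (((tendsto_cutoff x).eventually (t.lsc x r hx)).and
    self_mem_nhdsWithin).exists
  exact ⟨cutoff x ε, h, cutoff_approx x hε⟩

variable (A)

/-- The inclusion of the cone of traces into the lower semicontinuous functions on the predomain
`(A₊, ≺≺)`. -/
def toLSC (t : LSCTrace A) : LSC (cpTopology A) := ⟨t, t.lsc_cp⟩

/-- The weak* upper topology: the restriction of the upper topology of `LSC`. -/
@[reducible]
def upperTopology : TopologicalSpace (LSCTrace A) :=
  (Topology.upper (LSC (cpTopology A))).induced (toLSC A)

/-- The restriction of the lower topology of `LSC`. -/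
@[reducible]
def lowerTopology : TopologicalSpace (LSCTrace A) :=
  (Topology.lower (LSC (cpTopology A))).induced (toLSC A)

/-- The restriction of the interval topology of `LSC`. -/
@[reducible]
def ivTopology : TopologicalSpace (LSCTrace A) :=
  (intervalTopology (LSC (cpTopology A))).induced (toLSC A)

end LSCTrace

end CStar

/-!
The traces form a compact ordered space under `τ*_up ⊓ τ*_lo`, and the rest follows from Nachbin's
correspondence between compact ordered spaces and stably compact spaces.

*Convergence.* A net `tᵢ` converges to `t` for `τ*_up` iff every `r < t x` is eventually below
`tᵢ x` (`LSCTrace.tendsto_upperTopology_iff`), and for `τ*_lo` iff every `r > t x` is eventually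
above `tᵢ ((x - ε)₊)`, for all `ε > 0` (`LSCTrace.tendsto_lowerTopology_iff`). For the second
statement the step function of an open subset of `(A₊, ≺≺)` lying between `(x - ε)₊` and `x` is
needed. The set of `y` with `(x - ε)₊ ≺≺ y` would require `≺≺` to be transitive; the set of
elements reached from some `(x - δ)₊`, `δ < ε`, by a finite `≺≺`-chain (`chainsAbove`) is
obviously open, and traces are monotone along such chains.

*Compactness.* The pointwise limit `t₀` of an ultrafilter of traces is additive and satisfies the
trace identity but may fail to be lower semicontinuous. Its regularization
`a ↦ sup_{ε > 0} t₀((a - ε)₊)` is again a trace (`LSCTrace.ofTracial`) and is a limit of the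
ultrafilter in both topologies. The C*-algebraic input is twofold. First, `‖a - b‖ < ε` implies
`t₀((a - ε)₊) ≤ t₀(b)`, because `(a - ε)₊ ≤ k b k` for a positive contraction `k`
(`IsTracial.map_cutoff_le`); this yields lower semicontinuity and subadditivity. Second, if
`x* x ≤ c` and `e² c = (c - ε)₊`, then `‖x - x e‖² ≤ ε` (`norm_sub_mul_cutoffMul_sq_le`), so that
`t₀((x x* - δ)₊) ≤ t₀(e x* x e)` for small `ε` (`IsTracial.exists_map_cutoff_le`). Taking
`c = a + b` gives superadditivity, and `c = x* x` gives the trace identity.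

*Separation.* If `s ≰ t`, choose `t x < r < s((x - ε)₊)`: an upper open set on which
`r < u((x - ε)₊)` and a lower open set on which `u((x - ε)₊) < r` separate `s` from `t`. Hence
the graph of the order is closed, and a finite-subcover argument gives stable compactness of both
one-sided topologies (`IsCompactOrderedPair.isStablyCompact`).

*Operations.* Joint continuity for `τ*_up` and `τ*_lo` is a pointwise statement about `+` and `*` on
`[0, ∞]`, and the case of the interval topology follows from these two.
-/

/-! ### Compact ordered spaces presented by two topologies -/

open Topology in
/-- A compact ordered space in the presentation of Nachbin: `τ₁` consists of upper sets, `τ₂` of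
lower sets, their common refinement `τ₁ ⊓ τ₂` is compact, and whenever `x ≰ y` some `τ₁`-open
neighbourhood of `x` is disjoint from some `τ₂`-open neighbourhood of `y`. -/
structure IsCompactOrderedPair {X : Type*} [PartialOrder X] (τ₁ τ₂ : TopologicalSpace X) :
    Prop where
  compact : @CompactSpace X (τ₁ ⊓ τ₂)
  isUpperSet : ∀ U, IsOpen[τ₁] U → IsUpperSet U
  isLowerSet : ∀ V, IsOpen[τ₂] V → IsLowerSet V
  separated : ∀ x y : X, ¬ x ≤ y →
    ∃ U V, IsOpen[τ₁] U ∧ IsOpen[τ₂] V ∧ x ∈ U ∧ y ∈ V ∧ Disjoint U V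

theorem IsCompact.of_topology_le {X : Type*} {τ τ' : TopologicalSpace X} (h : τ ≤ τ') {K : Set X}
    (hK : @IsCompact X τ K) : @IsCompact X τ' K := by
  simpa using @IsCompact.image X X τ τ' K id hK (continuous_id_of_le h)

namespace IsCompactOrderedPair

open Topology

variable {X : Type*} [PartialOrder X] {τ₁ τ₂ : TopologicalSpace X}

theorem dual (h : IsCompactOrderedPair τ₁ τ₂) : IsCompactOrderedPair (X := Xᵒᵈ) τ₂ τ₁ where
  compact := inf_comm τ₁ τ₂ ▸ h.compact
  isUpperSet U hU _ _ hxy hx := h.isLowerSet U hU hxy hx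
  isLowerSet U hU _ _ hxy hx := h.isUpperSet U hU hxy hx
  separated x y hxy := by
    obtain ⟨U, V, hU, hV, hx, hy, hd⟩ := h.separated y x hxy
    exact ⟨V, U, hV, hU, hy, hx, hd.symm⟩

theorem isCompact_inf (h : IsCompactOrderedPair τ₁ τ₂) {K : Set X} (hK : IsClosed[τ₁ ⊓ τ₂] K) :
    @IsCompact X (τ₁ ⊓ τ₂) K :=
  @IsClosed.isCompact X (τ₁ ⊓ τ₂) K h.compact hK

theorem isCompact_of_isClosed (h : IsCompactOrderedPair τ₁ τ₂) {K : Set X}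
    (hK : IsClosed[τ₂] K) : @IsCompact X τ₁ K :=
  (h.isCompact_inf (hK.mono inf_le_right)).of_topology_le inf_le_left

/-- A point outside `K` is separated from each point of `K`, hence from finitely many `τ₁`-open sets
covering `K`. -/
theorem isClosed_of_isCompact (h : IsCompactOrderedPair τ₁ τ₂) {K : Set X}
    (hK : @IsCompact X τ₁ K) (hup : IsUpperSet K) : IsClosed[τ₂] K := by
  rw [← @isOpen_compl_iff X K τ₂, @isOpen_iff_forall_mem_open X τ₂ Kᶜ]
  intro y hy
  choose! U V hU hV hxU hyV hd using fun x (hx : x ∈ K) =>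
    h.separated x y fun hxy => hy (hup hxy hx)
  obtain ⟨t, htK, ht⟩ := @IsCompact.elim_nhds_subcover X τ₁ K hK U
    fun x hx => @IsOpen.mem_nhds X τ₁ x (U x) (hU x hx) (hxU x hx)
  refine ⟨⋂ x ∈ t, V x, fun z hz hzK => ?_,
    @isOpen_biInter_finset X X τ₂ t V fun x hx => hV x (htK x hx),
    Set.mem_iInter₂.2 fun x hx => hyV x (htK x hx)⟩
  obtain ⟨x, hx, hzx⟩ := Set.mem_iUnion₂.1 (ht hzK)
  exact Set.disjoint_left.1 (hd x (htK x hx)) hzx (Set.mem_iInter₂.1 hz x hx)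

theorem isUpperSet_of_isSaturatedSet (h : IsCompactOrderedPair τ₁ τ₂) {K : Set X}
    (hK : IsSaturatedSet τ₁ K) : IsUpperSet K := by
  intro x y hxy hx
  rw [← hK] at hx ⊢
  exact fun U hU => h.isUpperSet U hU.1 hxy (hx U hU)

/-- Let `W` be a `τ₁`-open neighbourhood of `x`. Finitely many `τ₂`-open sets, each disjoint from a
`τ₁`-neighbourhood of `x`, cover the complement of `W`; the complement of their union is a compact
neighbourhood of `x` inside `W`. -/
theorem locallyCompactSpace (h : IsCompactOrderedPair τ₁ τ₂) : @LocallyCompactSpace X τ₁ := by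
  refine @LocallyCompactSpace.mk X τ₁ fun x n hn => ?_
  obtain ⟨W, hWn, hW, hxW⟩ := (@mem_nhds_iff X τ₁ x n).1 hn
  choose! U V hU hV hxU hyV hd using fun y (hy : y ∈ Wᶜ) =>
    h.separated x y fun hxy => hy (h.isUpperSet W hW hxy hxW)
  have hWc : @IsCompact X τ₂ Wᶜ :=
    IsCompact.of_topology_le (τ := τ₁ ⊓ τ₂) inf_le_right
      (h.isCompact_inf (((@isClosed_compl_iff X τ₁ W).2 hW).mono inf_le_left))
  obtain ⟨t, htW, ht⟩ := @IsCompact.elim_nhds_subcover X τ₂ Wᶜ hWc V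
    fun y hy => @IsOpen.mem_nhds X τ₂ y (V y) (hV y hy) (hyV y hy)
  have hVo : IsOpen[τ₂] (⋃ y ∈ t, V y) :=
    @isOpen_biUnion X X τ₂ t V fun y hy => hV y (htW y hy)
  refine ⟨(⋃ y ∈ t, V y)ᶜ, ?_, (Set.compl_subset_comm.1 ht).trans hWn,
    h.isCompact_of_isClosed ((@isClosed_compl_iff X τ₂ _).2 hVo)⟩
  refine (@mem_nhds_iff X τ₁ x _).2 ⟨⋂ y ∈ t, U y, fun z hz hzV => ?_,
    @isOpen_biInter_finset X X τ₁ t U fun y hy => hU y (htW y hy),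
    Set.mem_iInter₂.2 fun y hy => hxU y (htW y hy)⟩
  obtain ⟨y, hy, hzy⟩ := Set.mem_iUnion₂.1 hzV
  exact Set.disjoint_left.1 (hd y (htW y hy)) (Set.mem_iInter₂.1 hz y hy) hzy

/-- An irreducible `τ₁`-closed set has a greatest element: otherwise finitely many `τ₂`-open sets
cover it, while the `τ₁`-open sets separated from them have a common point in it. -/
theorem quasiSober (h : IsCompactOrderedPair τ₁ τ₂) : @QuasiSober X τ₁ := by
  refine @QuasiSober.mk X τ₁ fun {F} hF hFc => ?_
  obtain ⟨x, hx, hmax⟩ : ∃ x ∈ F, ∀ y ∈ F, y ≤ x := by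
    by_contra! hcon
    choose! g hgF hg using hcon
    choose! U V hU hV hxU hyV hd using fun x (hx : x ∈ F) => h.separated (g x) x (hg x hx)
    have hFK : @IsCompact X τ₂ F :=
      IsCompact.of_topology_le (τ := τ₁ ⊓ τ₂) inf_le_right
        (h.isCompact_inf (hFc.mono inf_le_left))
    obtain ⟨t, htF, ht⟩ := @IsCompact.elim_nhds_subcover X τ₂ F hFK V
      fun y hy => @IsOpen.mem_nhds X τ₂ y (V y) (hV y hy) (hyV y hy)
    classical
    obtain ⟨z, hzF, hz⟩ := (@isIrreducible_iff_sInter X τ₁ F).1 hF (t.image U)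
      (by simpa using fun x hx => hU x (htF x hx))
      (by simpa using fun x hx => ⟨g x, hgF x (htF x hx), hxU x (htF x hx)⟩)
    obtain ⟨x, hx, hzx⟩ := Set.mem_iUnion₂.1 (ht hzF)
    exact Set.disjoint_left.1 (hd x (htF x hx)) (hz (U x) (by simpa using ⟨x, hx, rfl⟩)) hzx
  refine ⟨x, subset_antisymm (@closure_minimal X τ₁ _ _ (Set.singleton_subset_iff.2 hx) hFc) ?_⟩
  intro y hy
  rw [@mem_closure_iff X τ₁]
  exact fun U hU hyU => ⟨x, h.isUpperSet U hU (hmax y hy) hyU, rfl⟩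

theorem t0Space (h : IsCompactOrderedPair τ₁ τ₂) : @T0Space X τ₁ := by
  have key : ∀ x y : X, @Inseparable X τ₁ x y → x ≤ y := fun x y hxy => by
    by_contra hle
    obtain ⟨U, V, hU, -, hx, hy, hd⟩ := h.separated x y hle
    exact Set.disjoint_left.1 hd ((@inseparable_iff_forall_isOpen X τ₁ x y).1 hxy U hU |>.1 hx) hy
  exact @T0Space.mk X τ₁ fun x y hxy =>
    le_antisymm (key x y hxy) (key y x (@Inseparable.symm X τ₁ x y hxy))

theorem isStablyCompact (h : IsCompactOrderedPair τ₁ τ₂) : IsStablyCompact τ₁ where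
  compact := @CompactSpace.mk X τ₁ (h.isCompact_of_isClosed (@isClosed_univ X τ₂))
  locallyCompact := h.locallyCompactSpace
  quasiSober := h.quasiSober
  t0 := h.t0Space
  coherent K L hK hKs hL hLs := h.isCompact_of_isClosed <|
    @IsClosed.inter X K L τ₂ (h.isClosed_of_isCompact hK (h.isUpperSet_of_isSaturatedSet hKs))
      (h.isClosed_of_isCompact hL (h.isUpperSet_of_isSaturatedSet hLs))

theorem isStablyCompact_right (h : IsCompactOrderedPair τ₁ τ₂) : IsStablyCompact τ₂ :=
  h.dual.isStablyCompact (X := Xᵒᵈ)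

theorem isCompactOrderedSpace (h : IsCompactOrderedPair τ₁ τ₂) :
    IsCompactOrderedSpace (τ₁ ⊓ τ₂) := by
  refine @IsCompactOrderedSpace.mk X _ (τ₁ ⊓ τ₂) h.compact ?_
  let := τ₁ ⊓ τ₂
  rw [← isOpen_compl_iff, isOpen_iff_forall_mem_open]
  rintro ⟨x, y⟩ hxy
  obtain ⟨U, V, hU, hV, hx, hy, hd⟩ := h.separated x y hxy
  refine ⟨U ×ˢ V, ?_, IsOpen.prod (hU.mono inf_le_left) (hV.mono inf_le_right), hx, hy⟩
  rintro ⟨a, b⟩ ⟨ha, hb⟩ hab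
  exact Set.disjoint_left.1 hd (h.isUpperSet U hU hab ha) hb

end IsCompactOrderedPair

/-! ### Estimates in the positive cone -/

section PositiveCone

variable {A : Type*} [NonUnitalCStarAlgebra A] [PartialOrder A] [StarOrderedRing A]

/-- `x x*` as an element of the positive cone; `x* x` is `mulStar (star x)`. -/
def mulStar (x : A) : PosCone A := ⟨x * star x, mul_star_self_nonneg x⟩

theorem exists_mulStar_star (a : PosCone A) :
    ∃ y : A, mulStar y = a ∧ mulStar (star y) = a := by
  obtain ⟨y, hy, h⟩ := CStarAlgebra.nonneg_iff_exists_isSelfAdjoint_and_eq_mul_self.mp a.2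
  exact ⟨y, Subtype.ext (by simp [mulStar, hy.star_eq, h]),
    Subtype.ext (by simp [mulStar, hy.star_eq, h])⟩

theorem cutoff_zero (a : PosCone A) : cutoff a 0 = a := by
  refine Subtype.ext ?_
  conv_rhs => rw [← cfcₙ_id' ℝ (a : A) a.2.isSelfAdjoint]
  refine cfcₙ_congr fun x hx => ?_
  have := quasispectrum_nonneg_of_nonneg _ a.2 x hx
  simpa using this

theorem cutoff_le (a : PosCone A) {ε : ℝ} (hε : 0 ≤ ε) : cutoff a ε ≤ a := by
  simpa only [cutoff_zero] using cutoff_anti a le_rfl hε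

theorem norm_sub_cutoff_le (a : PosCone A) {ε : ℝ} (hε : 0 ≤ ε) :
    ‖(a : A) - cutoff a ε‖ ≤ ε := by
  have key : (a : A) - cutoff a ε = cfcₙ (fun x : ℝ => x - max (x - ε) 0) (a : A) := by
    rw [cfcₙ_sub (fun x : ℝ => x) (fun x : ℝ => max (x - ε) 0) (a : A) (by fun_prop) rfl
      (by fun_prop) (by simp [hε]), cfcₙ_id' ℝ (a : A) a.2.isSelfAdjoint]
    rfl
  rw [key]
  refine norm_cfcₙ_le fun x hx => ?_
  have hx := quasispectrum_nonneg_of_nonneg _ a.2 x hx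
  rw [Real.norm_eq_abs, abs_le]
  constructor <;> rcases max_cases (x - ε) 0 with h | h <;> linarith

/-- For `δ < ε`, the nonnegative function `k ≤ 1` with `k(x)² (x - δ) = (x - ε)₊`. Bounding the
denominator below by `ε - δ` changes nothing for `x ≥ ε` and makes `k` continuous. -/
noncomputable def cutoffRoot (δ ε x : ℝ) : ℝ := √(max (x - ε) 0 / max (x - δ) (ε - δ))

section cutoffRoot

variable {δ ε : ℝ}

theorem continuous_cutoffRoot (h : δ < ε) : Continuous (cutoffRoot δ ε) := by
  unfold cutoffRoot
  refine Real.continuous_sqrt.comp (Continuous.div (by fun_prop) (by fun_prop) fun x => ?_)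
  exact (lt_of_lt_of_le (sub_pos.2 h) (le_max_right _ _)).ne'

theorem cutoffRoot_zero (hε : 0 ≤ ε) : cutoffRoot δ ε 0 = 0 := by simp [cutoffRoot, hε]

theorem cutoffRoot_nonneg (x : ℝ) : 0 ≤ cutoffRoot δ ε x := Real.sqrt_nonneg _

theorem cutoffRoot_sq (h : δ < ε) (x : ℝ) :
    cutoffRoot δ ε x * cutoffRoot δ ε x = max (x - ε) 0 / max (x - δ) (ε - δ) :=
  Real.mul_self_sqrt (div_nonneg (le_max_right _ _)
    ((sub_pos.2 h).le.trans (le_max_right _ _)))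

theorem cutoffRoot_le_one (h : δ < ε) (x : ℝ) : cutoffRoot δ ε x ≤ 1 := by
  refine Real.sqrt_le_one.2 (div_le_one_of_le₀ ?_ ((sub_pos.2 h).le.trans (le_max_right _ _)))
  exact max_le_max (by linarith) (by linarith)

theorem cutoffRoot_sq_mul (h : δ < ε) (x : ℝ) :
    cutoffRoot δ ε x * cutoffRoot δ ε x * (x - δ) = max (x - ε) 0 := by
  rw [cutoffRoot_sq h]
  rcases le_total x ε with hx | hx
  · simp [max_eq_right (sub_nonpos.2 hx)]
  · rw [max_eq_left (a := x - δ) (by linarith), div_mul_cancel₀ _ (by linarith)]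

end cutoffRoot

/-- The element `k(c)` of `A`, where `k` is `cutoffRoot δ ε`. -/
noncomputable def cutoffMul (δ ε : ℝ) (c : PosCone A) : A := cfcₙ (cutoffRoot δ ε) (c : A)

section cutoffMul

variable {δ ε : ℝ}

omit [StarOrderedRing A] in
theorem star_cutoffMul (c : PosCone A) : star (cutoffMul δ ε c) = cutoffMul δ ε c :=
  (IsSelfAdjoint.cfcₙ (f := cutoffRoot δ ε) (a := (c : A))).star_eq

omit [StarOrderedRing A] in
theorem norm_cutoffMul_le (h : δ < ε) (c : PosCone A) : ‖cutoffMul δ ε c‖ ≤ 1 :=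
  norm_cfcₙ_le fun x _ => by
    rw [Real.norm_eq_abs, abs_of_nonneg (cutoffRoot_nonneg x)]
    exact cutoffRoot_le_one h x

omit [StarOrderedRing A] in
theorem cutoffMul_mul_self (h : δ < ε) (hε : 0 ≤ ε) (c : PosCone A) :
    cutoffMul δ ε c * cutoffMul δ ε c =
      cfcₙ (fun x => cutoffRoot δ ε x * cutoffRoot δ ε x) (c : A) :=
  (cfcₙ_mul _ _ _ (continuous_cutoffRoot h).continuousOn (cutoffRoot_zero hε)
    (continuous_cutoffRoot h).continuousOn (cutoffRoot_zero hε)).symm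

theorem cutoffMul_mul (h : δ < ε) (hε : 0 ≤ ε) (c : PosCone A) :
    cutoffMul δ ε c * c = cfcₙ (fun x => cutoffRoot δ ε x * x) (c : A) := by
  rw [cfcₙ_mul _ (fun x => x) _ (continuous_cutoffRoot h).continuousOn (cutoffRoot_zero hε)
    (by fun_prop) rfl, cfcₙ_id' ℝ (c : A) c.2.isSelfAdjoint]
  rfl

theorem mul_cutoffMul (h : δ < ε) (hε : 0 ≤ ε) (c : PosCone A) :
    c * cutoffMul δ ε c = cfcₙ (fun x => x * cutoffRoot δ ε x) (c : A) := by
  rw [cfcₙ_mul (fun x => x) _ _ (by fun_prop) rfl (continuous_cutoffRoot h).continuousOn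
    (cutoffRoot_zero hε), cfcₙ_id' ℝ (c : A) c.2.isSelfAdjoint]
  rfl

theorem cutoffMul_mul_mul (h : δ < ε) (hε : 0 ≤ ε) (c : PosCone A) :
    cutoffMul δ ε c * c * cutoffMul δ ε c =
      cfcₙ (fun x => cutoffRoot δ ε x * x * cutoffRoot δ ε x) (c : A) := by
  have := continuous_cutoffRoot h
  rw [cutoffMul_mul h hε, cutoffMul, ← cfcₙ_mul (fun x => cutoffRoot δ ε x * x) _ _
    (by fun_prop) (by simp) (by fun_prop) (cutoffRoot_zero hε)]

theorem cutoffMul_conj_sub (h : δ < ε) (hε : 0 ≤ ε) (c : PosCone A) :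
    cutoffMul δ ε c * c * cutoffMul δ ε c - δ • (cutoffMul δ ε c * cutoffMul δ ε c) =
      cutoff c ε := by
  have := continuous_cutoffRoot h
  rw [cutoffMul_mul_mul h hε, cutoffMul_mul_self h hε,
    ← cfcₙ_const_mul δ _ _ (by fun_prop) (by simp [cutoffRoot_zero hε]),
    ← cfcₙ_sub _ _ _ (by fun_prop) (by simp) (by fun_prop) (by simp [cutoffRoot_zero hε])]
  refine cfcₙ_congr fun x _ => ?_
  rw [← cutoffRoot_sq_mul h]
  ring

theorem cutoffMul_conj (hε : 0 < ε) (c : PosCone A) :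
    cutoffMul 0 ε c * c * cutoffMul 0 ε c = cutoff c ε := by
  simpa using cutoffMul_conj_sub hε hε.le c

/-- The norm of `(1 - e) c (1 - e)`, expanded since `A` need not have a unit. -/
theorem norm_one_sub_cutoffMul_conj_le (hε : 0 < ε) (c : PosCone A) :
    ‖(c : A) - c * cutoffMul 0 ε c - cutoffMul 0 ε c * c
      + cutoffMul 0 ε c * c * cutoffMul 0 ε c‖ ≤ ε := by
  have hk := continuous_cutoffRoot hε
  have hk0 := cutoffRoot_zero (δ := 0) hε.le
  have key : (c : A) - c * cutoffMul 0 ε c - cutoffMul 0 ε c * c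
      + cutoffMul 0 ε c * c * cutoffMul 0 ε c =
      cfcₙ (fun x : ℝ => x - x * cutoffRoot 0 ε x - cutoffRoot 0 ε x * x
        + cutoffRoot 0 ε x * x * cutoffRoot 0 ε x) (c : A) := by
    rw [cfcₙ_add _ _ _ (by fun_prop) (by simp) (by fun_prop) (by simp),
      cfcₙ_sub _ _ _ (by fun_prop) (by simp) (by fun_prop) (by simp),
      cfcₙ_sub _ _ _ (by fun_prop) (by simp) (by fun_prop) (by simp),
      cutoffMul_mul_mul hε hε.le, cutoffMul_mul hε hε.le, mul_cutoffMul hε hε.le,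
      cfcₙ_id' ℝ (c : A) c.2.isSelfAdjoint]
  rw [key]
  refine norm_cfcₙ_le fun x hx => ?_
  have hx := quasispectrum_nonneg_of_nonneg _ c.2 x hx
  have h0 := cutoffRoot_nonneg (δ := 0) (ε := ε) x
  have h1 := cutoffRoot_le_one hε x
  have h2 := cutoffRoot_sq_mul hε x
  generalize cutoffRoot 0 ε x = k at h0 h1 h2
  have h3 : x - ε ≤ k * k * x := by simpa using (le_max_left (x - ε) 0).trans h2.ge
  -- `0 ≤ (1 - k)² x ≤ (1 - k²) x ≤ ε`
  have h4 : 0 ≤ x * ((1 - k) * (1 - k)) := by positivity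
  have h5 : 0 ≤ x * (k * (1 - k)) := mul_nonneg hx (mul_nonneg h0 (sub_nonneg.2 h1))
  rw [Real.norm_eq_abs, abs_le]
  constructor <;> linarith

/-- If `x* x ≤ c`, then `x e` approximates `x` for `e = cutoffMul 0 ε c`. -/
theorem norm_sub_mul_cutoffMul_sq_le (hε : 0 < ε) {x : A} {c : PosCone A}
    (h : mulStar (star x) ≤ c) : ‖x - x * cutoffMul 0 ε c‖ ^ 2 ≤ ε := by
  set e := cutoffMul 0 ε c with he
  have hes : star e = e := star_cutoffMul c
  have hd : 0 ≤ (c : A) - star x * x :=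
    sub_nonneg.2 (by simpa [mulStar] using Subtype.coe_le_coe.2 h)
  obtain ⟨z, hz, hz'⟩ := CStarAlgebra.nonneg_iff_exists_isSelfAdjoint_and_eq_mul_self.mp hd
  rw [sq, ← CStarRing.norm_star_mul_self]
  refine le_trans (CStarAlgebra.norm_le_norm_of_nonneg_of_le (star_mul_self_nonneg _) ?_)
    (norm_one_sub_cutoffMul_conj_le hε c)
  rw [← he, ← sub_nonneg]
  have := star_mul_self_nonneg (z - z * e)
  convert this using 1
  have hc : (c : A) = star x * x + z * z := by rw [← hz']; abel
  simp only [hc, star_sub, star_mul, hes, hz.star_eq]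
  noncomm_ring

theorem norm_mulStar_sub_le (x y : A) :
    ‖(mulStar x : A) - mulStar y‖ ≤ (‖x‖ + ‖y‖) * ‖x - y‖ := by
  have : (mulStar x : A) - mulStar y = x * star (x - y) + (x - y) * star y := by
    simp only [mulStar, star_sub]
    noncomm_ring
  rw [this]
  refine (norm_add_le _ _).trans ?_
  have h1 := norm_mul_le x (star (x - y))
  have h2 := norm_mul_le (x - y) (star y)
  rw [norm_star] at h1 h2
  linarith

end cutoffMul

/-! ### Regularization of tracial maps -/

/-- The trace identity for maps on the positive cone without any semicontinuity. -/
def IsTracial (t : PosCone A →+ ℝ≥0∞) : Prop := ∀ x : A, t (mulStar x) = t (mulStar (star x))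

theorem PosCone.map_mono (t : PosCone A →+ ℝ≥0∞) {a b : PosCone A} (h : a ≤ b) : t a ≤ t b := by
  have hb : b = a + ⟨(b : A) - a, sub_nonneg.mpr h⟩ := Subtype.ext (by simp)
  rw [hb, map_add]
  exact le_self_add

namespace IsTracial

variable {t : PosCone A →+ ℝ≥0∞} (ht : IsTracial t)

include ht

/-- A tracial map does not increase under compression of `y y*` by a contraction `x`, as
`(x y)* (x y) = y* (x* x) y ≤ y* y`. -/
theorem map_conj_le {x y : A} (hx : ‖x‖ ≤ 1) :
    t (mulStar (x * y)) ≤ t (mulStar y) := by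
  rw [ht (x * y), ht y]
  refine PosCone.map_mono t (Subtype.coe_le_coe.1 ?_)
  have h := CStarAlgebra.star_left_conjugate_le_norm_smul (a := y) (b := star x * x)
  have h1 : ‖star x * x‖ ≤ 1 := by
    rw [CStarRing.norm_star_mul_self]
    exact mul_le_one₀ hx (norm_nonneg _) hx
  have h2 : ‖star x * x‖ • (star y * y) ≤ star y * y := by
    simpa using smul_le_smul_of_nonneg_right h1 (star_mul_self_nonneg y)
  simpa [mulStar, mul_assoc] using h.trans h2

/-- Elements that are close in norm are comparable under a tracial map: for `k = cutoffMul δ ε a`,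
`(a - ε)₊ = k (a - δ) k ≤ k b k`. -/
theorem map_cutoff_le {a b : PosCone A} {δ ε : ℝ} (hδ : ‖(a : A) - b‖ ≤ δ) (h : δ < ε) :
    t (cutoff a ε) ≤ t b := by
  have hε : 0 ≤ ε := (norm_nonneg _).trans (hδ.trans h.le)
  obtain ⟨y, hy, -⟩ := exists_mulStar_star b
  rw [← hy] at hδ ⊢
  refine le_trans (PosCone.map_mono t (Subtype.coe_le_coe.1 ?_))
    (ht.map_conj_le (x := cutoffMul δ ε a) (norm_cutoffMul_le h a))
  set k := cutoffMul δ ε a with hk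
  have hks : star k = k := star_cutoffMul a
  have h1 := CStarAlgebra.star_left_conjugate_le_norm_smul (a := k)
    (b := (a : A) - mulStar y) (a.2.isSelfAdjoint.sub (mulStar y).2.isSelfAdjoint)
  have h2 := h1.trans (smul_le_smul_of_nonneg_right hδ (star_mul_self_nonneg k))
  rw [hks, mul_sub, sub_mul, sub_le_iff_le_add] at h2
  rw [← cutoffMul_conj_sub h hε, ← hk, sub_le_iff_le_add]
  refine h2.trans_eq ?_
  simp only [mulStar, star_mul, hks]
  noncomm_ring

/-- If `x* x ≤ c`, then for small `ε` the element `(x x* - δ)₊` is dominated, under a tracial map,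
by the compression of `x* x` that turns `c` into `(c - ε)₊`. -/
theorem exists_map_cutoff_le {x : A} {δ : ℝ} (hδ : 0 < δ) :
    ∃ ε₀ > 0, ∀ ε, 0 < ε → ε ≤ ε₀ → ∀ c : PosCone A, mulStar (star x) ≤ c →
      t (cutoff (mulStar x) δ) ≤ t (mulStar (star (x * cutoffMul 0 ε c))) := by
  have hM : 0 < 4 * (‖x‖ + 1) := by positivity
  refine ⟨(δ / (4 * (‖x‖ + 1))) ^ 2, by positivity, fun ε hε hεε c hc => ?_⟩
  rw [← ht]
  refine ht.map_cutoff_le (δ := δ / 2) ?_ (half_lt_self hδ)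
  have h1 : ‖x - x * cutoffMul 0 ε c‖ ≤ δ / (4 * (‖x‖ + 1)) :=
    le_of_sq_le_sq ((norm_sub_mul_cutoffMul_sq_le hε hc).trans hεε) (by positivity)
  have h2 : ‖x * cutoffMul 0 ε c‖ ≤ ‖x‖ := (norm_mul_le _ _).trans
    (mul_le_of_le_one_right (norm_nonneg _) (norm_cutoffMul_le hε c))
  refine (norm_mulStar_sub_le _ _).trans ?_
  calc _ ≤ (2 * (‖x‖ + 1)) * (δ / (4 * (‖x‖ + 1))) :=
        mul_le_mul (by linarith) h1 (norm_nonneg _) (by positivity)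
    _ = δ / 2 := by field_simp; norm_num

end IsTracial

/-- The lower semicontinuous regularization `a ↦ sup_{ε > 0} t ((a - ε)₊)`. -/
noncomputable def regularize (t : PosCone A →+ ℝ≥0∞) (a : PosCone A) : ℝ≥0∞ :=
  ⨆ ε : {ε : ℝ // 0 < ε}, t (cutoff a ε)

theorem map_cutoff_le_regularize (t : PosCone A →+ ℝ≥0∞) (a : PosCone A) {ε : ℝ} (hε : 0 < ε) :
    t (cutoff a ε) ≤ regularize t a :=
  le_iSup (fun ε : {ε : ℝ // 0 < ε} => t (cutoff a ε)) ⟨ε, hε⟩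

theorem lt_regularize_iff {t : PosCone A →+ ℝ≥0∞} {a : PosCone A} {r : ℝ≥0∞} :
    r < regularize t a ↔ ∃ ε, 0 < ε ∧ r < t (cutoff a ε) := by
  simp [regularize, lt_iSup_iff]

theorem regularize_le (t : PosCone A →+ ℝ≥0∞) (a : PosCone A) : regularize t a ≤ t a :=
  iSup_le fun ε => PosCone.map_mono t (cutoff_le a ε.2.le)

namespace IsTracial

variable {t : PosCone A →+ ℝ≥0∞} (ht : IsTracial t)

include ht

theorem regularize_add_le (a b : PosCone A) :
    regularize t (a + b) ≤ regularize t a + regularize t b := by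
  refine iSup_le fun ⟨ε, hε⟩ => ?_
  have h4 : (0 : ℝ) < ε / 4 := by positivity
  refine (ht.map_cutoff_le (b := cutoff a (ε / 4) + cutoff b (ε / 4)) (δ := ε / 2) ?_
    (half_lt_self hε)).trans ?_
  · have h : ((a + b : PosCone A) : A) - (cutoff a (ε / 4) + cutoff b (ε / 4) : PosCone A) =
        ((a : A) - cutoff a (ε / 4)) + ((b : A) - cutoff b (ε / 4)) := by
      simp only [Nonneg.coe_add]
      abel
    rw [h]
    refine (norm_add_le _ _).trans ?_
    linarith [norm_sub_cutoff_le a h4.le, norm_sub_cutoff_le b h4.le]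
  · rw [map_add]
    exact add_le_add (map_cutoff_le_regularize t a h4) (map_cutoff_le_regularize t b h4)

theorem le_regularize_add (a b : PosCone A) :
    regularize t a + regularize t b ≤ regularize t (a + b) := by
  refine ENNReal.iSup_add_iSup_le fun ⟨δ₁, h₁⟩ ⟨δ₂, h₂⟩ => ?_
  obtain ⟨x, hx, hx'⟩ := exists_mulStar_star a
  obtain ⟨y, hy, hy'⟩ := exists_mulStar_star b
  obtain ⟨ε₁, hε₁, H₁⟩ := ht.exists_map_cutoff_le (x := x) h₁
  obtain ⟨ε₂, hε₂, H₂⟩ := ht.exists_map_cutoff_le (x := y) h₂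
  have hε : 0 < min ε₁ ε₂ := lt_min hε₁ hε₂
  refine le_trans (add_le_add (hx ▸ H₁ _ hε (min_le_left _ _) (a + b) ?_)
    (hy ▸ H₂ _ hε (min_le_right _ _) (a + b) ?_)) ?_
  rotate_left
  · rw [hx']; exact le_add_of_nonneg_right b.2
  · rw [hy']; exact le_add_of_nonneg_left a.2
  rw [← map_add]
  refine le_trans (le_of_eq (congrArg t (Subtype.ext ?_)))
    (map_cutoff_le_regularize t (a + b) hε)
  have hxa : star x * x = (a : A) := by simpa [mulStar] using congrArg Subtype.val hx'
  have hyb : star y * y = (b : A) := by simpa [mulStar] using congrArg Subtype.val hy'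
  rw [← cutoffMul_conj hε]
  simp only [mulStar, Nonneg.coe_add, star_mul, star_star, star_cutoffMul, ← hxa, ← hyb]
  noncomm_ring

theorem regularize_mulStar_le (x : A) :
    regularize t (mulStar x) ≤ regularize t (mulStar (star x)) := by
  refine iSup_le fun ⟨δ, hδ⟩ => ?_
  obtain ⟨ε, hε, H⟩ := ht.exists_map_cutoff_le (x := x) hδ
  refine (H ε hε le_rfl _ le_rfl).trans
    (le_trans (le_of_eq (congrArg t (Subtype.ext ?_))) (map_cutoff_le_regularize t _ hε))
  rw [← cutoffMul_conj hε]
  simp only [mulStar, star_mul, star_star, star_cutoffMul]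
  noncomm_ring

theorem lowerSemicontinuous_regularize : LowerSemicontinuous (regularize t) := by
  intro a r hr
  obtain ⟨ε, hε, h⟩ := lt_regularize_iff.1 hr
  have h4 : (0 : ℝ) < ε / 4 := by positivity
  filter_upwards [Metric.ball_mem_nhds a h4] with b hb
  refine h.trans_le ((ht.map_cutoff_le (b := cutoff b (ε / 4)) (δ := ε / 2) ?_
    (half_lt_self hε)).trans (map_cutoff_le_regularize t b h4))
  have hab : ‖(a : A) - b‖ < ε / 4 := by
    rw [← dist_eq_norm, dist_comm]
    exact hb
  have h := norm_add_le ((a : A) - b) (b - cutoff b (ε / 4))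
  rw [sub_add_sub_cancel] at h
  linarith [norm_sub_cutoff_le b h4.le]

end IsTracial

namespace LSCTrace

/-- The lower semicontinuous trace obtained by regularizing a tracial map. -/
noncomputable def ofTracial (t : PosCone A →+ ℝ≥0∞) (ht : IsTracial t) : LSCTrace A where
  toFun := regularize t
  map_zero' := le_antisymm ((regularize_le t 0).trans_eq (map_zero t)) zero_le
  map_add' a b := le_antisymm (ht.regularize_add_le a b) (ht.le_regularize_add a b)
  lsc' := ht.lowerSemicontinuous_regularize
  trace' x := by
    have h := ht.regularize_mulStar_le (star x)
    have h' := le_antisymm (ht.regularize_mulStar_le x) (by rwa [star_star] at h)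
    simpa only [mulStar, star_star] using h'

end LSCTrace

end PositiveCone

/-! ### Subbasic neighbourhoods of a trace -/

section Topologies

open Filter Topology

/-- The complement of `{f | r < f x}` is the principal ideal of the lower semicontinuous function
equal to `r` on the closure of `x` and to `∞` elsewhere. -/
theorem LSC.isOpen_lt_apply {P : Type*} (τ : TopologicalSpace P) (x : P) (r : ℝ≥0∞) :
    IsOpen[Topology.upper (LSC τ)] {f : LSC τ | r < f.1 x} := by
  classical
  let g : P → ℝ≥0∞ := fun y => if y ∈ closure {x} then r else ⊤
  have hg : LowerSemicontinuous g := by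
    intro y c hc
    by_cases hy : y ∈ closure {x}
    · have hc : c < r := by simpa [g, hy] using hc
      refine Eventually.of_forall fun z => hc.trans_le ?_
      by_cases hz : z ∈ closure {x} <;> simp [g, hz]
    · filter_upwards [isClosed_closure.isOpen_compl.mem_nhds hy] with z hz
      have hz : z ∉ closure {x} := hz
      have hc : c < ⊤ := by simpa [g, hy] using hc
      simpa [g, hz] using hc
  refine TopologicalSpace.isOpen_generateFrom_of_mem ⟨⟨g, hg⟩, ?_⟩
  ext f
  refine not_iff_comm.1 ?_
  change ¬ r < f.1 x ↔ f.1 ≤ g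
  rw [not_lt]
  refine ⟨fun h y => ?_, fun h => by simpa [g, subset_closure (Set.mem_singleton x)] using h x⟩
  by_cases hy : y ∈ closure {x}
  · have hcl : IsClosed {y | f.1 y ≤ r} := f.2.isClosed_preimage r
    have := closure_minimal (Set.singleton_subset_iff.2 (show x ∈ {y | f.1 y ≤ r} from h)) hcl hy
    simpa [g, hy] using this
  · simp [g, hy]

variable {A : Type*} [NonUnitalCStarAlgebra A] [PartialOrder A] [StarOrderedRing A]

theorem CPApprox.exists_cutoff {a b : PosCone A} (h : CPApprox a b) :
    ∃ ε, 0 < ε ∧ ∀ t : LSCTrace A, t a ≤ t (cutoff b ε) := by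
  obtain ⟨a', ε, hε, e, l⟩ := h
  exact ⟨ε, hε, fun t => (t.eq_of_equiv e).trans_le (t.mono l)⟩

/-- The elements that can be reached from some `(x - δ)₊` with `δ < ε` by a finite `≺≺`-chain. On
this neighbourhood of `x` the traces are bounded below by their value at `(x - ε)₊`. -/
def chainsAbove (x : PosCone A) (ε : ℝ) : Set (PosCone A) :=
  {w | ∃ δ, 0 < δ ∧ δ < ε ∧ Relation.ReflTransGen CPApprox (cutoff x δ) w}

theorem isOpen_chainsAbove (x : PosCone A) (ε : ℝ) : IsOpen[cpTopology A] (chainsAbove x ε) := by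
  refine ⟨?_, ?_⟩
  · rintro w ⟨δ, h0, h1, h⟩ y hy
    exact ⟨δ, h0, h1, h.tail hy⟩
  · rintro w ⟨δ, h0, h1, h⟩
    rcases Relation.ReflTransGen.cases_tail h with rfl | ⟨v, hv, hvw⟩
    · obtain ⟨δ', h2, h3⟩ := exists_between h1
      refine ⟨cutoff x δ', ⟨δ', h0.trans h2, h3, .refl⟩, ?_⟩
      have := cutoff_approx (cutoff x δ) (sub_pos.2 h2)
      rwa [cutoff_cutoff x h0.le (sub_pos.2 h2).le, add_sub_cancel] at this
    · exact ⟨v, ⟨δ, h0, h1, hv⟩, hvw⟩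

theorem mem_chainsAbove (x : PosCone A) {ε : ℝ} (hε : 0 < ε) : x ∈ chainsAbove x ε :=
  ⟨ε / 2, half_pos hε, half_lt_self hε, .single (cutoff_approx x (half_pos hε))⟩

namespace LSCTrace

theorem apply_cutoff_le (t : LSCTrace A) {x w : PosCone A} {ε : ℝ} (h : w ∈ chainsAbove x ε) :
    t (cutoff x ε) ≤ t w := by
  obtain ⟨δ, h0, h1, h⟩ := h
  refine (t.mono (cutoff_anti x h0.le h1.le)).trans ?_
  clear h1
  induction h with
  | refl => exact le_rfl
  | tail _ hbc ih => exact ih.trans (t.le_of_approx hbc)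

theorem exists_lt_apply_cutoff (t : LSCTrace A) {x : PosCone A} {r : ℝ≥0∞} (h : r < t x) :
    ∃ ε, 0 < ε ∧ r < t (cutoff x ε) := by
  obtain ⟨ε, h, hε⟩ := (((tendsto_cutoff x).eventually (t.lsc x r h)).and
    self_mem_nhdsWithin).exists
  exact ⟨ε, hε, h⟩

variable (A) in
theorem isOpen_lt_apply (x : PosCone A) (r : ℝ≥0∞) :
    IsOpen[upperTopology A] {t : LSCTrace A | r < t x} :=
  @isOpen_induced _ _ (Topology.upper (LSC (cpTopology A))) _ _
    (LSC.isOpen_lt_apply (cpTopology A) x r)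

variable {ι : Type*} {l : Filter ι} {f : ι → LSCTrace A} {t : LSCTrace A}

/-- Convergence for the weak* upper topology. -/
theorem tendsto_upperTopology_iff :
    Tendsto f l (@nhds _ (upperTopology A) t) ↔ ∀ x, ∀ r < t x, ∀ᶠ i in l, r < f i x := by
  refine ⟨fun h x r hr => h.eventually
    (@IsOpen.mem_nhds _ (upperTopology A) _ _ (isOpen_lt_apply A x r) hr), fun h => ?_⟩
  rw [@nhds_induced, tendsto_comap_iff, TopologicalSpace.tendsto_nhds_generateFrom_iff]
  rintro _ ⟨g, rfl⟩ hg
  obtain ⟨x, hx⟩ : ∃ x, g.1 x < t x := by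
    by_contra! hcon
    exact hg hcon
  filter_upwards [h x _ hx] with i hi hle
  exact (hi.trans_le (hle x)).false

/-- The lower semicontinuous function `r · 1` on `chainsAbove x ε` provides a subbasic
neighbourhood, for the weak* lower topology, of every trace whose value at `x` is below `r`. -/
theorem exists_isOpen_lowerTopology (x : PosCone A) {ε : ℝ} (hε : 0 < ε) (r : ℝ≥0∞) :
    ∃ V, IsOpen[lowerTopology A] V ∧ (∀ t : LSCTrace A, t x < r → t ∈ V) ∧
      ∀ t ∈ V, t (cutoff x ε) < r := by
  let g : LSC (cpTopology A) := ⟨(chainsAbove x ε).indicator fun _ => r,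
    let := cpTopology A
    (isOpen_chainsAbove x ε).lowerSemicontinuous_indicator zero_le⟩
  refine ⟨toLSC A ⁻¹' (Set.Ici g)ᶜ, ?_, fun t ht hle => ?_, fun t ht => ?_⟩
  · exact @isOpen_induced _ _ (Topology.lower (LSC (cpTopology A))) _ _
      (TopologicalSpace.isOpen_generateFrom_of_mem ⟨g, rfl⟩)
  · have h : (chainsAbove x ε).indicator (fun _ => r) x ≤ t x := hle x
    rw [Set.indicator_of_mem (mem_chainsAbove x hε)] at h
    exact (ht.trans_le h).false
  · by_contra! hr
    refine ht fun w => ?_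
    change (chainsAbove x ε).indicator (fun _ => r) w ≤ t w
    exact Set.indicator_le' (fun w hw => hr.trans (t.apply_cutoff_le hw)) (fun _ _ => zero_le) w

/-- Convergence for the weak* lower topology. -/
theorem tendsto_lowerTopology_iff :
    Tendsto f l (@nhds _ (lowerTopology A) t) ↔
      ∀ x ε, 0 < ε → ∀ r, t x < r → ∀ᶠ i in l, f i (cutoff x ε) < r := by
  refine ⟨fun h x ε hε r hr => ?_, fun h => ?_⟩
  · obtain ⟨V, hV, h1, h2⟩ := exists_isOpen_lowerTopology x hε r
    exact (h.eventually (@IsOpen.mem_nhds _ (lowerTopology A) _ _ hV (h1 t hr))).mono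
      fun i hi => h2 _ hi
  rw [@nhds_induced, tendsto_comap_iff, TopologicalSpace.tendsto_nhds_generateFrom_iff]
  rintro _ ⟨g, rfl⟩ hg
  obtain ⟨x, hx⟩ : ∃ x, t x < g.1 x := by
    by_contra! hcon
    exact hg hcon
  obtain ⟨c, hc, hcg⟩ := exists_between hx
  -- `{y | c < g y}` is open for the c-space topology, hence contains some `z ≺≺ x`.
  obtain ⟨z, hz, hzx⟩ := (@LowerSemicontinuous.isOpen_preimage _ _ (cpTopology A) _ _ g.2 c).2 x hcg
  obtain ⟨ε, hε, H⟩ := CPApprox.exists_cutoff hzx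
  filter_upwards [h x ε hε c hc] with i hi hle
  exact ((hz.trans_le (hle z)).trans_le (H (f i))).trans hi |>.false

/-! ### Compactness and separation -/

/-- Ultrafilters converge: the pointwise limit of the traces is additive and tracial, and its
regularization is the limit in both topologies. -/
theorem exists_ultrafilter_le_nhds (𝒰 : Ultrafilter (LSCTrace A)) :
    ∃ t, ↑𝒰 ≤ @nhds _ (upperTopology A ⊓ lowerTopology A) t := by
  have hlim : ∀ a : PosCone A, ∃ c : ℝ≥0∞, Tendsto (fun s : LSCTrace A => s a) 𝒰 (𝓝 c) := by
    intro a
    obtain ⟨c, -, hc⟩ := isCompact_iff_ultrafilter_le_nhds.1 (isCompact_univ (X := ℝ≥0∞))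
      (𝒰.map fun s => s a) (by simp)
    exact ⟨c, hc⟩
  choose φ hφ using hlim
  let t₀ : PosCone A →+ ℝ≥0∞ :=
    { toFun := φ
      map_zero' := tendsto_nhds_unique (hφ 0) (by simp)
      map_add' := fun a b => tendsto_nhds_unique (hφ (a + b))
        (((hφ a).add (hφ b)).congr fun s => (map_add s a b).symm) }
  have ht₀ : IsTracial t₀ := fun x => tendsto_nhds_unique (hφ (mulStar x))
    ((hφ (mulStar (star x))).congr fun s => by simpa [mulStar] using (s.trace x).symm)
  refine ⟨ofTracial t₀ ht₀, ?_⟩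
  rw [@nhds_inf, le_inf_iff]
  refine ⟨tendsto_id'.1 (tendsto_upperTopology_iff.2 fun x r hr => ?_),
    tendsto_id'.1 (tendsto_lowerTopology_iff.2 fun x ε hε r hr => ?_)⟩
  · obtain ⟨ε, hε, h⟩ := lt_regularize_iff.1 hr
    filter_upwards [(hφ _).eventually (lt_mem_nhds h)] with s hs
    exact hs.trans_le (s.mono (cutoff_le x hε.le))
  · exact (hφ _).eventually (gt_mem_nhds ((map_cutoff_le_regularize t₀ x hε).trans_lt hr))

variable (A) in
theorem isCompactOrderedPair : IsCompactOrderedPair (upperTopology A) (lowerTopology A) where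
  compact := by
    let := upperTopology A ⊓ lowerTopology A
    refine ⟨isCompact_iff_ultrafilter_le_nhds.2 fun 𝒰 _ => ?_⟩
    obtain ⟨t, ht⟩ := exists_ultrafilter_le_nhds 𝒰
    exact ⟨t, trivial, ht⟩
  isUpperSet := by
    rintro U hU s t hst hs
    -- The constant net `t` converges to every `s ≤ t`.
    have h : Tendsto (fun _ : Unit => t) (pure ()) (@nhds _ (upperTopology A) s) :=
      tendsto_upperTopology_iff.2 fun x r hr => Eventually.of_forall fun _ => hr.trans_le (hst x)
    exact eventually_pure.1 <| h.eventually (@IsOpen.mem_nhds _ (upperTopology A) _ _ hU hs)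
  isLowerSet := by
    rintro V hV s t hts hs
    have h : Tendsto (fun _ : Unit => t) (pure ()) (@nhds _ (lowerTopology A) s) :=
      tendsto_lowerTopology_iff.2 fun x ε hε r hr => Eventually.of_forall fun _ =>
        ((t.mono (cutoff_le x hε.le)).trans (hts x)).trans_lt hr
    exact eventually_pure.1 <| h.eventually (@IsOpen.mem_nhds _ (lowerTopology A) _ _ hV hs)
  separated s t hst := by
    obtain ⟨x, hx⟩ : ∃ x, t x < s x := by
      by_contra! hcon
      exact hst hcon
    obtain ⟨r, hr, hrs⟩ := exists_between hx
    obtain ⟨ε, hε, h⟩ := s.exists_lt_apply_cutoff hrs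
    obtain ⟨V, hV, h1, h2⟩ := exists_isOpen_lowerTopology x hε r
    exact ⟨_, V, isOpen_lt_apply A (cutoff x ε) r, hV, h, h1 t hr,
      Set.disjoint_left.2 fun u hu hu' => (hu.trans (h2 u hu')).false⟩

variable (A) in
theorem ivTopology_eq : ivTopology A = upperTopology A ⊓ lowerTopology A := induced_inf

/-! ### Continuity of the cone operations -/

theorem continuous_upperTopology {Z : Type*} {τ : TopologicalSpace Z} {f : Z → LSCTrace A}
    (h : ∀ x, LowerSemicontinuous fun z => f z x) :
    @Continuous _ _ τ (upperTopology A) f :=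
  (@continuous_iff_continuousAt _ _ τ (upperTopology A) f).2 fun z =>
    tendsto_upperTopology_iff.2 fun x r hr => h x z r hr

theorem continuous_lowerTopology {Z : Type*} {τ : TopologicalSpace Z} {f : Z → LSCTrace A}
    (h : ∀ z x ε, 0 < ε → ∀ r, f z x < r → ∀ᶠ w in 𝓝 z, f w (cutoff x ε) < r) :
    @Continuous _ _ τ (lowerTopology A) f :=
  (@continuous_iff_continuousAt _ _ τ (lowerTopology A) f).2 fun z =>
    tendsto_lowerTopology_iff.2 (h z)

variable (A) in
theorem lowerSemicontinuous_apply (x : PosCone A) :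
    @LowerSemicontinuous _ _ (upperTopology A) _ fun t : LSCTrace A => t x :=
  (@lowerSemicontinuous_iff_isOpen_preimage _ _ (upperTopology A) _ _).2 (isOpen_lt_apply A x)

theorem eventually_apply_cutoff_lt (t : LSCTrace A) (x : PosCone A) {ε : ℝ} (hε : 0 < ε)
    {r : ℝ≥0∞} (h : t x < r) :
    ∀ᶠ s : LSCTrace A in @nhds _ (lowerTopology A) t, s (cutoff x ε) < r :=
  tendsto_lowerTopology_iff.1 (@tendsto_id _ (@nhds _ (lowerTopology A) t)) x ε hε r h

end LSCTrace

/-! ### One-sided topologies on the positive reals -/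

theorem PosReal.isOpen_upper_lt (r : PosReal) : IsOpen[Topology.upper PosReal] {s | r < s} :=
  TopologicalSpace.isOpen_generateFrom_of_mem ⟨r, by ext; simp⟩

theorem PosReal.isOpen_lower_lt (r : PosReal) : IsOpen[Topology.lower PosReal] {s | s < r} :=
  TopologicalSpace.isOpen_generateFrom_of_mem ⟨r, by ext; simp⟩

theorem PosReal.lowerSemicontinuous_ofReal :
    @LowerSemicontinuous _ _ (Topology.upper PosReal) _ fun r : PosReal => ENNReal.ofReal r := by
  intro r c hc
  obtain ⟨d, hcd, hd⟩ := exists_between hc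
  have hd' : d ≠ ⊤ := hd.ne_top
  let q : PosReal := ⟨d.toReal, ENNReal.toReal_pos (zero_le.trans_lt hcd).ne' hd'⟩
  have hq : q < r := ENNReal.toReal_lt_of_lt_ofReal hd
  filter_upwards [@IsOpen.mem_nhds _ (Topology.upper PosReal) _ _
    (PosReal.isOpen_upper_lt q) hq] with s hs
  refine hcd.trans_le ((ENNReal.ofReal_toReal hd').symm.trans_le ?_)
  exact ENNReal.ofReal_le_ofReal (le_of_lt hs)

theorem PosReal.eventually_ofReal_lt (r : PosReal) {c : ℝ≥0∞} (h : ENNReal.ofReal r < c) :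
    ∀ᶠ s : PosReal in @nhds _ (Topology.lower PosReal) r, ENNReal.ofReal s < c := by
  obtain ⟨d, hd, hdc⟩ := exists_between h
  have hd' : d ≠ ⊤ := hdc.ne_top
  let q : PosReal := ⟨d.toReal, ENNReal.toReal_pos (zero_le.trans_lt hd).ne' hd'⟩
  have hq : r < q := (ENNReal.ofReal_lt_iff_lt_toReal r.2.le hd').1 hd
  filter_upwards [@IsOpen.mem_nhds _ (Topology.lower PosReal) _ _
    (PosReal.isOpen_lower_lt q) hq] with s hs
  refine lt_of_le_of_lt ?_ hdc
  exact (ENNReal.ofReal_le_ofReal (le_of_lt hs)).trans_eq (ENNReal.ofReal_toReal hd')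

theorem LowerSemicontinuous.ennreal_mul {Z : Type*} [TopologicalSpace Z] {f g : Z → ℝ≥0∞}
    (hf : LowerSemicontinuous f) (hg : LowerSemicontinuous g) :
    LowerSemicontinuous fun z => f z * g z := by
  intro z c hc
  obtain ⟨p, hp, q, hq, hpq⟩ : ∃ p < f z, ∃ q < g z, c < p * q := by
    by_contra! hcon
    exact hc.not_ge (ENNReal.mul_le_of_forall_lt hcon)
  filter_upwards [hf z p hp, hg z q hq] with w h1 h2
  exact hpq.trans_le (mul_le_mul' h1.le h2.le)

theorem PosReal.usualTopology_le_upper :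
    PosReal.usualTopology ≤ Topology.upper PosReal := by
  refine le_generateFrom ?_
  rintro _ ⟨r, rfl⟩
  exact isClosed_Iic.isOpen_compl

theorem PosReal.usualTopology_le_lower :
    PosReal.usualTopology ≤ Topology.lower PosReal := by
  refine le_generateFrom ?_
  rintro _ ⟨r, rfl⟩
  exact isClosed_Ici.isOpen_compl

theorem prod_topology_mono {X Y : Type*} {a a' : TopologicalSpace X}
    {b b' : TopologicalSpace Y} (ha : a ≤ a') (hb : b ≤ b') :
    @instTopologicalSpaceProd X Y a b ≤ @instTopologicalSpaceProd X Y a' b' :=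
  inf_le_inf (induced_mono ha) (induced_mono hb)

theorem IsTopologicalCone.inf {C : Type*} [Cone C] {σ σ₁ σ₂ : TopologicalSpace PosReal}
    {τ₁ τ₂ : TopologicalSpace C} (h₁ : IsTopologicalCone σ₁ τ₁) (h₂ : IsTopologicalCone σ₂ τ₂)
    (hσ₁ : σ ≤ σ₁) (hσ₂ : σ ≤ σ₂) : IsTopologicalCone σ (τ₁ ⊓ τ₂) := by
  refine @IsTopologicalCone.mk _ _ σ (τ₁ ⊓ τ₂) ?_ ?_
  · exact (@continuous_inf_rng _ _ _ (_) τ₁ τ₂).2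
      ⟨continuous_le_dom (prod_topology_mono inf_le_left inf_le_left) h₁.continuous_add,
        continuous_le_dom (prod_topology_mono inf_le_right inf_le_right) h₂.continuous_add⟩
  · exact (@continuous_inf_rng _ _ _ (_) τ₁ τ₂).2
      ⟨continuous_le_dom (prod_topology_mono hσ₁ inf_le_left) h₁.continuous_smul,
        continuous_le_dom (prod_topology_mono hσ₂ inf_le_right) h₂.continuous_smul⟩

namespace LSCTrace

/-! ### The topological cones of traces -/

variable (A) in
theorem isTopologicalCone_upper :
    IsTopologicalCone (Topology.upper PosReal) (upperTopology A) := by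
  let := upperTopology A
  refine @IsTopologicalCone.mk _ _ (Topology.upper PosReal) (upperTopology A) ?_ ?_
  · refine continuous_upperTopology fun x => ?_
    exact ((lowerSemicontinuous_apply A x).comp continuous_fst).add
      ((lowerSemicontinuous_apply A x).comp continuous_snd)
  · let : TopologicalSpace PosReal := Topology.upper PosReal
    refine continuous_upperTopology fun x => ?_
    exact (PosReal.lowerSemicontinuous_ofReal.comp continuous_fst).ennreal_mul
      ((lowerSemicontinuous_apply A x).comp continuous_snd)

variable (A) in
theorem isTopologicalCone_lower :
    IsTopologicalCone (Topology.lower PosReal) (lowerTopology A) := by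
  let := lowerTopology A
  refine @IsTopologicalCone.mk _ _ (Topology.lower PosReal) (lowerTopology A) ?_ ?_
  · refine continuous_lowerTopology fun ⟨s, t⟩ x ε hε r hr => ?_
    obtain ⟨p, hp, q, hq, hpq⟩ := ENNReal.exists_add_lt_of_add_lt hr
    rw [nhds_prod_eq]
    filter_upwards [(eventually_apply_cutoff_lt s x hε hp).prod_mk
      (eventually_apply_cutoff_lt t x hε hq)] with w hw
    exact (ENNReal.add_lt_add hw.1 hw.2).trans hpq
  · let : TopologicalSpace PosReal := Topology.lower PosReal
    refine continuous_lowerTopology fun ⟨a, t⟩ x ε hε r hr => ?_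
    obtain ⟨p, hp, q, hq, hpq⟩ : ∃ p > ENNReal.ofReal a, ∃ q > t x, p * q < r := by
      by_contra! hcon
      exact hr.not_ge (ENNReal.le_mul_of_forall_lt (.inl (ENNReal.ofReal_pos.2 a.2).ne')
        (.inl ENNReal.ofReal_ne_top) hcon)
    rw [nhds_prod_eq]
    filter_upwards [(PosReal.eventually_ofReal_lt a hp).prod_mk
      (eventually_apply_cutoff_lt t x hε hq)] with w hw
    exact (mul_le_mul' hw.1.le hw.2.le).trans_lt hpq

variable (A) in
theorem isOrderedCone : IsOrderedCone (LSCTrace A) where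
  monotone_add _ _ h x := add_le_add (h.1 x) (h.2 x)
  monotone_smul _ _ h x := mul_le_mul' (ENNReal.ofReal_le_ofReal h.1) (h.2 x)

end LSCTrace

end Topologies

theorem mainTheorem2 (A : Type*) [NonUnitalCStarAlgebra A] [PartialOrder A] [StarOrderedRing A] :
    (IsCompactOrderedSpace (LSCTrace.ivTopology A) ∧
      IsOrderedCone (LSCTrace A) ∧
      IsTopologicalCone PosReal.usualTopology (LSCTrace.ivTopology A)) ∧
    (IsStablyCompact (LSCTrace.upperTopology A) ∧
      IsTopologicalCone (Topology.upper PosReal) (LSCTrace.upperTopology A)) ∧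
    (IsStablyCompact (LSCTrace.lowerTopology A) ∧
      IsTopologicalCone (Topology.lower PosReal) (LSCTrace.lowerTopology A)) := by
  have h := LSCTrace.isCompactOrderedPair A
  have hup := LSCTrace.isTopologicalCone_upper A
  have hlo := LSCTrace.isTopologicalCone_lower A
  rw [LSCTrace.ivTopology_eq]
  exact ⟨⟨h.isCompactOrderedSpace, LSCTrace.isOrderedCone A,
    hup.inf hlo PosReal.usualTopology_le_upper PosReal.usualTopology_le_lower⟩,
    ⟨h.isStablyCompact, hup⟩, ⟨h.isStablyCompact_right, hlo⟩⟩
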